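/- A reduced billiard table word is a word in the letters $+,-$ of the form $$w=(+)^{\varepsilon_1}(-)^{\varepsilon_2}(+)^{\varepsilon_3}(-)^{\varepsilon_4}\cdots(\pm)^{\varepsilon_c},\qquad c\ge 3,$$ (signs alternating, starting with $+$) with all $\varepsilon_i\in\{1,2\}$, $\varepsilon_1=\varepsilon_c=1$, and length $\ell=\sum_{i=1}^c\varepsilon_i\equiv 1 \pmod 3$. Its alternating diagram $D$ is the plat closure of the 3-strand braid word with $c$ letters whose $i$-th letter is obtained from the $i$-th run of $w$ by the rule $$+\mapsto\sigma_1,\qquad ++\mapsto\sigma_2^{-1},\qquad -\mapsto\sigma_2^{-1},\qquad --\mapsto\sigma_1 .$$ Here the braid is drawn horizontally, read from left to right, with strands numbered $1,2,3$ from bottom to top, and in $\sigma_j$ the $j$-th strand passes over the $(j+1)$-st. The plat closure joins strands $2,3$ by a cap on the left, leaving strand $1$ as a free end there; on the right, it joins strands $2,3$ by a cap and leaves strand $1$ free if $c$ is odd, and it joins strands $1,2$ by a cap and leaves strand $3$ free if $c$ is even. The two free ends are joined through infinity, and the resulting diagram is given an orientation. A crossing of $D$ is vertically-smoothed if its two strands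 are both oriented upwards or both oriented downwards. The height of a crossing $\sigma_j^{\pm1}$ is $j$. A vertically-smoothed crossing is viable if the next vertically-smoothed crossing (to its right) is at the same height, or if it is the last vertically-smoothed crossing. Theorem. For every reduced billiard table word $w$, the number of Seifert circles of $D$ (the closed curves obtained by smoothing all crossings of $D$ according to the orientation) equals two plus the number of viable vertically-smoothed crossings of $D$. -/

import Mathlib

namespace BilliardKnot

/-- The letters `+` and `-` of a billiard table word. -/
inductive Sign
  | plus
  | minus
  deriving DecidableEq

/-- The maximal runs of equal letters of a word, from left to right. -/
def runs (w : List Sign) : List (List Sign) :=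
  w.splitBy (fun a b => decide (a = b))

/-- `w = (+)^{ε₁} (-)^{ε₂} (+)^{ε₃} ⋯` with `c ≥ 3` runs, all `εᵢ ∈ {1, 2}`, `ε₁ = ε_c = 1`,
and length `∑ εᵢ ≡ 1 (mod 3)`. -/
structure IsReducedWord (w : List Sign) : Prop where
  starts_plus : w.head? = some Sign.plus
  three_le : 3 ≤ (runs w).length
  run_length : ∀ r ∈ runs w, r.length = 1 ∨ r.length = 2
  first_single : ∀ r ∈ (runs w).head?, r.length = 1
  last_single : ∀ r ∈ (runs w).getLast?, r.length = 1
  length_mod : w.length % 3 = 1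

/-- A crossing of a 3-strand braid diagram, that is, a letter `σ₁^{±1}` or `σ₂^{±1}`.
The strands run horizontally at the heights `0, 1, 2`; the crossing exchanges the heights
`pos` and `pos + 1` (so it is `σ_{pos+1}^{±1}`). If `risingOver` is true (a letter `σ^{+1}`), the strand
which rises from left to right is the overstrand, otherwise (a letter `σ^{-1}`) the strand which
falls from left to right is. -/
structure Crossing where
  pos : Fin 2
  risingOver : Bool

/-- The lower of the two heights at which a crossing sits. -/
def Crossing.lower (x : Crossing) : Fin 3 := x.pos.castSucc

/-- The upper of the two heights at which a crossing sits. -/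
def Crossing.upper (x : Crossing) : Fin 3 := x.pos.succ

/-- `σ₁` -/
def sigma1 : Crossing := ⟨0, true⟩

/-- `σ₂⁻¹` -/
def sigma2Inv : Crossing := ⟨1, false⟩

/-- The crossing that replaces a run: `+ ↦ σ₁`, `++ ↦ σ₂⁻¹`, `- ↦ σ₂⁻¹`, `-- ↦ σ₁`.
(The last line is never used for runs of reduced words.) -/
def runCrossing : List Sign → Crossing
  | [Sign.plus] => sigma1
  | [Sign.plus, Sign.plus] => sigma2Inv
  | [Sign.minus] => sigma2Inv
  | [Sign.minus, Sign.minus] => sigma1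
  | _ => sigma1

/-- A 3-strand braid word, read from left to right, regarded as the diagram of its plat closure
(as a long knot whose two ends are joined through infinity): on the left the heights `1, 2` are
joined by a cap and height `0` is the free end; on the right the heights `1, 2` are joined by a cap
and height `0` is the free end if the number of crossings is odd, while the heights `0, 1` are
joined by a cap and height `2` is the free end if it is even. -/
abbrev Diagram := List Crossing

/-- The alternating diagram of a reduced billiard table word. -/
def alternatingDiagram (w : List Sign) : Diagram := (runs w).map runCrossing

namespace Diagram

/-- The points where the vertical lines that separate the crossings meet the diagram:
`(i, y)` is the point of height `y` after `i` crossings. -/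
abbrev Point (D : Diagram) : Type := Fin (D.length + 1) × Fin 3

/-- The height of the free end on the right. -/
def rightFree (D : Diagram) : Fin 3 := if Odd D.length then 0 else 2

/-- The lower height of the cap on the right. -/
def rightCapLow (D : Diagram) : Fin 3 := if Odd D.length then 1 else 0

/-- The upper height of the cap on the right. -/
def rightCapHigh (D : Diagram) : Fin 3 := if Odd D.length then 2 else 1

/-- An orientation of the diagram: every point is passed either from left to right (`true`) or
from right to left (`false`), coherently along the strands, around the two caps and along the arc
through infinity which joins the two free ends. -/
structure Orientation (D : Diagram) where
  right : D.Point → Bool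
  strand : ∀ (i : Fin D.length) (y : Fin 3),
    right (i.castSucc, y) = right (i.succ, Equiv.swap D[i].lower D[i].upper y)
  leftCap : right (0, 1) = !right (0, 2)
  rightCap : right (Fin.last _, D.rightCapLow) = !right (Fin.last _, D.rightCapHigh)
  freeEnds : right (0, 0) = right (Fin.last _, D.rightFree)

/-- The permutation of heights from the point after `n` crossings back to the left end. -/
def heightPerm (D : Diagram) : ℕ → Equiv.Perm (Fin 3)
  | 0 => 1
  | n + 1 => if h : n < D.length then D.heightPerm n * Equiv.swap D[n].lower D[n].upper
      else D.heightPerm n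

theorem nonempty_orientation (D : Diagram) : Nonempty D.Orientation := by
  have key : ∀ p : Equiv.Perm (Fin 3),
      (∃ s : Fin 3 → Bool, s 1 = !s 2 ∧ s (p 1) = !s (p 2) ∧ s 0 = s (p 0)) ∧
      (∃ s : Fin 3 → Bool, s 1 = !s 2 ∧ s (p 0) = !s (p 1) ∧ s 0 = s (p 2)) := by decide
  have : ∃ s : Fin 3 → Bool, s 1 = !s 2 ∧
      s (D.heightPerm D.length D.rightCapLow) = !s (D.heightPerm D.length D.rightCapHigh) ∧
      s 0 = s (D.heightPerm D.length D.rightFree) := by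
    by_cases h : Odd D.length
    · simpa [rightCapLow, rightCapHigh, rightFree, h] using (key (D.heightPerm D.length)).1
    · simpa [rightCapLow, rightCapHigh, rightFree, h] using (key (D.heightPerm D.length)).2
  obtain ⟨s, h1, h2, h3⟩ := this
  exact ⟨{
    right := fun p => s (D.heightPerm p.1 p.2)
    strand := by intro i y; simp [heightPerm]
    leftCap := by simpa [heightPerm] using h1
    rightCap := by simpa using h2
    freeEnds := by simpa [heightPerm] using h3 }⟩

variable {D : Diagram}

namespace Orientation

/-- The starting point of the strand rising from left to right at crossing `i`. -/
def riseIn (o : D.Orientation) (i : Fin D.length) : D.Point :=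
  if o.right (i.castSucc, D[i].lower) then (i.castSucc, D[i].lower) else (i.succ, D[i].upper)

/-- The end point of the strand rising from left to right at crossing `i`. -/
def riseOut (o : D.Orientation) (i : Fin D.length) : D.Point :=
  if o.right (i.castSucc, D[i].lower) then (i.succ, D[i].upper) else (i.castSucc, D[i].lower)

/-- The starting point of the strand falling from left to right at crossing `i`. -/
def fallIn (o : D.Orientation) (i : Fin D.length) : D.Point :=
  if o.right (i.castSucc, D[i].upper) then (i.castSucc, D[i].upper) else (i.succ, D[i].lower)

/-- The end point of the strand falling from left to right at crossing `i`. -/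
def fallOut (o : D.Orientation) (i : Fin D.length) : D.Point :=
  if o.right (i.castSucc, D[i].upper) then (i.succ, D[i].lower) else (i.castSucc, D[i].upper)

/-- Crossing `i` is vertically-smoothed: its two strands are both oriented upwards or both oriented
downwards. (The rising strand is oriented upwards if it is run through from left to right, the
falling one if it is run through from right to left.) -/
def IsVertical (o : D.Orientation) (i : Fin D.length) : Prop :=
  (o.right (i.castSucc, D[i].lower) = true ∧ o.right (i.castSucc, D[i].upper) = false) ∨
  (o.right (i.castSucc, D[i].lower) = false ∧ o.right (i.castSucc, D[i].upper) = true)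

/-- A vertically-smoothed crossing is viable if the next vertically-smoothed crossing is at the
same height, or if it is the last vertically-smoothed crossing. -/
def IsViable (o : D.Orientation) (i : Fin D.length) : Prop :=
  o.IsVertical i ∧
    ((∃ j, i < j ∧ o.IsVertical j ∧ (∀ k, i < k → k < j → ¬ o.IsVertical k) ∧
        D[j].pos = D[i].pos) ∨
      ∀ j, i < j → ¬ o.IsVertical j)

/-- The arcs of the diagram in which every crossing is smoothed following the orientation: each
of the two incoming ends at a crossing is joined to the outgoing end of the other strand. -/
inductive SeifertArc (o : D.Orientation) : D.Point → D.Point → Prop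
  | pass (i : Fin D.length) (y : Fin 3) (hl : y ≠ D[i].lower) (hu : y ≠ D[i].upper) :
      SeifertArc o (i.castSucc, y) (i.succ, y)
  | riseFall (i : Fin D.length) : SeifertArc o (o.riseIn i) (o.fallOut i)
  | fallRise (i : Fin D.length) : SeifertArc o (o.fallIn i) (o.riseOut i)
  | leftCap : SeifertArc o (0, 1) (0, 2)
  | rightCap : SeifertArc o (Fin.last _, D.rightCapLow) (Fin.last _, D.rightCapHigh)
  | freeEnds : SeifertArc o (0, 0) (Fin.last _, D.rightFree)

/-- The number of Seifert circles: the number of connected components of the smoothed diagram. -/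
noncomputable def numSeifertCircles (o : D.Orientation) : ℕ :=
  Nat.card (SimpleGraph.fromRel o.SeifertArc).ConnectedComponent

end Orientation

end Diagram

end BilliardKnot

namespace BilliardKnot

/-! A non-vertical crossing is smoothed into horizontal strands that keep their heights, while a
vertical one closes off its two heights on both sides and lets the third strand pass. So only the
sequence of heights of the vertical crossings matters. Two consecutive ones at the same height bound
a circle of their own, and the third strand passes by. Two at different heights join all three
strands into a Z, which only continues the circle through infinity. If the first vertical crossing
is at the height of the left cap and the last at that of the right cap, the circles are the one
through infinity, the one starting at the left cap, and one to the right of each viable crossing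
(`numSeifertCircles_eq`).

The arithmetic of the word enters only in this condition on the ends. The permutation of the strands
depends only on the length modulo 3 and the parity of the number of runs (`perm_map_runCrossing`).
Length 1 modulo 3 forces the free strand to have the orientation of the strand at height 1 at both
ends (`IsReducedWord.right_ends`), so no extreme vertical crossing can involve a free end. -/

/-- The other letter. -/
def Sign.flip : Sign → Sign
  | plus => minus
  | minus => plus

/-- A list of runs of length one or two with alternating letters, the first letter being `s`. -/
def IsAlternating : Sign → List (List Sign) → Prop
  | _, [] => True
  | s, r :: rs => (r = [s] ∨ r = [s, s]) ∧ IsAlternating s.flip rs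

theorem eq_replicate_of_isChain_eq {r : List Sign} (h : r.IsChain (· = ·)) (s : Sign)
    (hs : r.head? = some s) : r = List.replicate r.length s := by
  induction r with
  | nil => rfl
  | cons a r ih =>
    obtain rfl : a = s := by simpa using hs
    cases r with
    | nil => rfl
    | cons b r =>
      rw [List.isChain_cons_cons] at h
      obtain ⟨rfl, h⟩ := h
      rw [ih h rfl]
      simp [List.replicate_succ]

theorem isAlternating_of_isChain (rs : List (List Sign)) (s : Sign)
    (hlen : ∀ r ∈ rs, r.length = 1 ∨ r.length = 2)
    (heq : ∀ r ∈ rs, r.IsChain (· = ·))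
    (halt : rs.IsChain fun a b => ∃ ha hb, a.getLast ha ≠ b.head hb)
    (hs : ∀ r ∈ rs.head?, r.head? = some s) : IsAlternating s rs := by
  induction rs generalizing s with
  | nil => trivial
  | cons r rs ih =>
    have hr := eq_replicate_of_isChain_eq (heq r (by simp)) s (hs r rfl)
    have hr' : r = [s] ∨ r = [s, s] := by
      rcases hlen r (by simp) with h | h
      · left; rw [hr, h]; rfl
      · right; rw [hr, h]; rfl
    refine ⟨hr', ih _ (fun x hx => hlen x (by simp [hx])) (fun x hx => heq x (by simp [hx]))
      halt.tail ?_⟩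
    intro q hq
    cases rs with
    | nil => simp at hq
    | cons q' rs =>
      obtain rfl : q' = q := by simpa using hq
      rw [List.isChain_cons_cons] at halt
      obtain ⟨⟨ha, hb, hab⟩, -⟩ := halt
      have hl : r.getLast ha = s := by rcases hr' with h | h <;> simp [h]
      rw [hl] at hab
      rw [List.head?_eq_some_head hb]
      generalize q'.head hb = t at hab
      cases s <;> cases t <;> first | rfl | exact absurd rfl hab

theorem IsReducedWord.isAlternating_runs {w : List Sign} (hw : IsReducedWord w) :
    IsAlternating Sign.plus (runs w) := by
  refine isAlternating_of_isChain _ _ hw.run_length (fun r hr => ?_) ?_ ?_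
  · simpa using List.isChain_of_mem_splitBy hr
  · simpa [runs] using List.isChain_getLast_head_splitBy (fun a b : Sign => decide (a = b)) w
  · have hne : w ≠ [] := by rintro rfl; simpa using hw.starts_plus
    intro r hr
    have hr' : runs w ≠ [] := List.splitBy_ne_nil.2 hne
    rw [List.head?_eq_some_head hr', Option.mem_some_iff] at hr
    subst hr
    have := List.head_head_splitBy (fun a b : Sign => decide (a = b)) hne
    have h2 := hw.starts_plus
    rw [List.head?_eq_some_head hne, Option.some_inj, ← this] at h2
    rw [← h2]
    exact List.head?_eq_some_head _

/-! ### Strand permutation and orientation at the two ends. -/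

/-- The permutation of the heights from the right end to the left end. -/
def Diagram.perm (D : Diagram) : Equiv.Perm (Fin 3) :=
  (D.map fun x => Equiv.swap x.lower x.upper).prod

theorem Diagram.heightPerm_length (D : Diagram) : D.heightPerm D.length = D.perm := by
  have : ∀ n ≤ D.length,
      D.heightPerm n = ((D.take n).map fun x => Equiv.swap x.lower x.upper).prod := by
    intro n hn
    induction n with
    | zero => simp [heightPerm]
    | succ n ih =>
      rw [heightPerm, dif_pos (by omega), ih (by omega), List.take_succ_eq_append_getElem (by omega)]
      simp only [List.map_append, List.prod_append, List.map_cons, List.map_nil, List.prod_singleton]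
  rw [this _ le_rfl, List.take_length, perm]

/-- The permutation of an alternating list of runs in terms of its first letter, its total length
modulo three, and the parity of the number of runs (`true` if odd). -/
def alternatingPerm : Sign → Fin 3 → Bool → Equiv.Perm (Fin 3)
  | Sign.plus, n, false => (Equiv.swap 0 1 * Equiv.swap 1 2) ^ (2 * n.val)
  | Sign.minus, n, false => (Equiv.swap 0 1 * Equiv.swap 1 2) ^ n.val
  | Sign.plus, n, true => Equiv.swap 0 1 * (Equiv.swap 0 1 * Equiv.swap 1 2) ^ (n.val + 2)
  | Sign.minus, n, true => Equiv.swap 1 2 * (Equiv.swap 0 1 * Equiv.swap 1 2) ^ (2 * (n.val + 2))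

/-- Put `s = (0 1)`, `t = (1 2)` and `r = s * t`, of order 3. A plus run of length `ε` gives `s * r
^ (ε - 1)`, a minus run `t * r ^ (1 - ε)`. Moving a reflection past `r` inverts it, which cancels
the opposite sign for minus runs, so the lengths add up in the exponent. The factor 2 and the
summand 2 in `alternatingPerm` stand for -1 modulo 3. -/
theorem perm_map_runCrossing {s : Sign} {rs : List (List Sign)} (h : IsAlternating s rs) :
    Diagram.perm (rs.map runCrossing) =
      alternatingPerm s (Fin.ofNat 3 rs.flatten.length) (decide (Odd rs.length)) := by
  induction rs generalizing s with
  | nil => cases s <;> rfl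
  | cons r rs ih =>
    have hperm : Diagram.perm ((r :: rs).map runCrossing) =
        Equiv.swap (runCrossing r).lower (runCrossing r).upper *
          Diagram.perm (rs.map runCrossing) := by simp [Diagram.perm]
    have hodd : decide (Odd (r :: rs).length) = !decide (Odd rs.length) := by
      simp only [List.length_cons, Nat.odd_add_one, decide_not]
    have hlen : Fin.ofNat 3 (r :: rs).flatten.length =
        Fin.ofNat 3 r.length + Fin.ofNat 3 rs.flatten.length := by
      ext; simp [Fin.val_add]
    rw [hperm, hodd, hlen, ih h.2]
    generalize Fin.ofNat 3 rs.flatten.length = n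
    generalize decide (Odd rs.length) = b
    rcases h.1 with rfl | rfl <;> cases s <;> cases b <;> revert n <;> decide

theorem IsReducedWord.perm_alternatingDiagram {w : List Sign} (hw : IsReducedWord w) :
    (alternatingDiagram w).perm =
      alternatingPerm Sign.plus 1 (decide (Odd (alternatingDiagram w).length)) := by
  have h := perm_map_runCrossing hw.isAlternating_runs
  have hl : Fin.ofNat 3 (runs w).flatten.length = 1 := by
    rw [runs, List.flatten_splitBy]
    ext
    simpa using hw.length_mod
  rw [hl] at h
  simpa [alternatingDiagram] using h

namespace Diagram.Orientation

variable {D : Diagram}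

theorem right_eq_heightPerm (o : D.Orientation) (n : ℕ) (hn : n < D.length + 1) (y : Fin 3) :
    o.right (⟨n, hn⟩, y) = o.right (0, D.heightPerm n y) := by
  induction n generalizing y with
  | zero => rfl
  | succ n ih =>
    have hn' : n < D.length := by omega
    have := o.strand ⟨n, hn'⟩ (Equiv.swap D[n].lower D[n].upper y)
    simp only [Fin.getElem_fin, Equiv.swap_apply_self, Fin.succ_mk, Fin.castSucc_mk] at this
    rw [← this, ih, heightPerm, dif_pos hn', Equiv.Perm.mul_apply]

theorem right_last (o : D.Orientation) (y : Fin 3) :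
    o.right (Fin.last _, y) = o.right (0, D.perm y) := by
  rw [← heightPerm_length]
  exact o.right_eq_heightPerm _ (by omega) y

end Diagram.Orientation

-- In both parities the permutation sends the right free height to 1 and height 1 to 0; combined
-- with the arc through infinity this gives both equalities.
open Diagram in
theorem IsReducedWord.right_ends {w : List Sign} (hw : IsReducedWord w)
    (o : (alternatingDiagram w).Orientation) :
    o.right (0, 0) = o.right (0, 1) ∧
      o.right (Fin.last _, rightFree (alternatingDiagram w)) = o.right (Fin.last _, 1) := by
  have hf := o.freeEnds
  have hp := hw.perm_alternatingDiagram
  rw [hf.symm, o.right_last 1, hp]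
  rw [o.right_last, hp] at hf
  unfold rightFree at hf
  by_cases h : Odd (alternatingDiagram w).length
  · simp only [h, if_true, decide_true] at hf ⊢
    rw [show alternatingPerm Sign.plus 1 true 0 = 1 by decide] at hf
    rw [show alternatingPerm Sign.plus 1 true 1 = 0 by decide]
    exact ⟨hf, rfl⟩
  · simp only [h, if_false, decide_false] at hf ⊢
    rw [show alternatingPerm Sign.plus 1 false 2 = 1 by decide] at hf
    rw [show alternatingPerm Sign.plus 1 false 1 = 0 by decide]
    exact ⟨hf, rfl⟩


/-! ### Smoothings of a single crossing. -/

theorem Crossing.pos_eq_zero_or_one (x : Crossing) : x.pos = 0 ∨ x.pos = 1 := by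
  obtain ⟨p, b⟩ := x
  revert p; decide +revert

/-- The height of the strand that takes no part in the crossing. -/
def Crossing.third (x : Crossing) : Fin 3 := if x.pos = 0 then 2 else 0

theorem Crossing.third_ne_lower (x : Crossing) : x.third ≠ x.lower := by
  rcases x.pos_eq_zero_or_one with h | h <;> simp [third, lower, h]

theorem Crossing.third_ne_upper (x : Crossing) : x.third ≠ x.upper := by
  rcases x.pos_eq_zero_or_one with h | h <;> simp [third, upper, h]

theorem Crossing.eq_lower_or_upper_or_third (x : Crossing) (y : Fin 3) :
    y = x.lower ∨ y = x.upper ∨ y = x.third := by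
  rcases x.pos_eq_zero_or_one with h | h <;> simp only [third, upper, lower, h] <;>
    revert y <;> decide

namespace Diagram.Orientation

variable {D : Diagram} (o : D.Orientation)

theorem isVertical_iff (i : Fin D.length) :
    o.IsVertical i ↔ o.right (i.castSucc, D[i].lower) ≠ o.right (i.castSucc, D[i].upper) := by
  unfold IsVertical
  cases o.right (i.castSucc, D[i].lower) <;> cases o.right (i.castSucc, D[i].upper) <;> simp

theorem right_succ (i : Fin D.length) (y : Fin 3) :
    o.right (i.succ, y) = o.right (i.castSucc, Equiv.swap D[i].lower D[i].upper y) := by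
  simp [o.strand]

theorem right_succ_of_not_isVertical {i : Fin D.length} (h : ¬ o.IsVertical i) (y : Fin 3) :
    o.right (i.succ, y) = o.right (i.castSucc, y) := by
  rw [isVertical_iff, not_not] at h
  rw [right_succ]
  rcases D[i].eq_lower_or_upper_or_third y with rfl | rfl | rfl
  · rw [Equiv.swap_apply_left, h]
  · rw [Equiv.swap_apply_right, h]
  · rw [Equiv.swap_apply_of_ne_of_ne D[i].third_ne_lower D[i].third_ne_upper]

/-- Two columns with no vertically-smoothed crossing between them carry the same orientation. -/
theorem right_eq_of_not_isVertical {a b : Fin (D.length + 1)} (hab : a ≤ b)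
    (h : ∀ k : Fin D.length, a ≤ k.castSucc → k.castSucc < b → ¬ o.IsVertical k) (y : Fin 3) :
    o.right (b, y) = o.right (a, y) := by
  induction b using Fin.induction with
  | zero => rw [Fin.le_zero_iff.1 hab]
  | succ i ih =>
    rcases hab.eq_or_lt with rfl | hlt
    · rfl
    · have hle : a ≤ i.castSucc := Fin.le_castSucc_iff.2 hlt
      rw [o.right_succ_of_not_isVertical (h i hle (Fin.castSucc_lt_succ)),
        ih hle fun k h1 h2 => h k h1 (h2.trans Fin.castSucc_lt_succ)]

/-- Being joined in the smoothed diagram. -/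
abbrev Joined (a b : D.Point) : Prop := (SimpleGraph.fromRel o.SeifertArc).Reachable a b

variable {o}

theorem SeifertArc.joined {a b : D.Point} (h : o.SeifertArc a b) : o.Joined a b := by
  by_cases hab : a = b
  · rw [hab]
  · exact SimpleGraph.Adj.reachable ((SimpleGraph.fromRel_adj _ _ _).2 ⟨hab, Or.inl h⟩)

theorem joined_third (i : Fin D.length) :
    o.Joined (i.castSucc, D[i].third) (i.succ, D[i].third) :=
  (SeifertArc.pass i _ D[i].third_ne_lower D[i].third_ne_upper).joined

/-- Both strands cross in the same horizontal direction, so exchanging their outgoing ends undoes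
the exchange of heights. -/
theorem joined_of_not_isVertical {i : Fin D.length} (h : ¬ o.IsVertical i) (y : Fin 3) :
    o.Joined (i.castSucc, y) (i.succ, y) := by
  rw [isVertical_iff, not_not] at h
  have h1 := (SeifertArc.riseFall (o := o) i).joined
  have h2 := (SeifertArc.fallRise (o := o) i).joined
  unfold riseIn fallOut at h1
  unfold fallIn riseOut at h2
  rcases D[i].eq_lower_or_upper_or_third y with rfl | rfl | rfl
  · cases hb : o.right (i.castSucc, D[i].upper) <;> simp only [h, hb] at h1 h2
    · exact h2.symm
    · exact h1
  · cases hb : o.right (i.castSucc, D[i].upper) <;> simp only [h, hb] at h1 h2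
    · exact h1.symm
    · exact h2
  · exact joined_third i

theorem IsVertical.joined {i : Fin D.length} (h : o.IsVertical i) :
    o.Joined (i.castSucc, D[i].lower) (i.castSucc, D[i].upper) ∧
      o.Joined (i.succ, D[i].lower) (i.succ, D[i].upper) := by
  have h1 := (SeifertArc.riseFall (o := o) i).joined
  have h2 := (SeifertArc.fallRise (o := o) i).joined
  unfold riseIn fallOut at h1
  unfold fallIn riseOut at h2
  rcases h with ⟨ha, hb⟩ | ⟨ha, hb⟩ <;> simp only [ha, hb] at h1 h2
  · exact ⟨h1, h2⟩
  · exact ⟨h2.symm, h1.symm⟩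

/-- A map which is compatible with the horizontal and the vertical smoothings and with the
closure arcs is constant along arcs. -/
theorem SeifertArc.map_eq {β : Type*} {f : D.Point → β}
    (hthird : ∀ i : Fin D.length, f (i.castSucc, D[i].third) = f (i.succ, D[i].third))
    (hhor : ∀ i : Fin D.length, ¬ o.IsVertical i → ∀ y, f (i.castSucc, y) = f (i.succ, y))
    (hver : ∀ i : Fin D.length, o.IsVertical i →
      f (i.castSucc, D[i].lower) = f (i.castSucc, D[i].upper) ∧
      f (i.succ, D[i].lower) = f (i.succ, D[i].upper))
    (hleft : f (0, 1) = f (0, 2))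
    (hright : f (Fin.last _, D.rightCapLow) = f (Fin.last _, D.rightCapHigh))
    (hfree : f (0, 0) = f (Fin.last _, D.rightFree))
    {a b : D.Point} (h : o.SeifertArc a b) : f a = f b := by
  cases h with
  | pass i y hl hu =>
    rcases D[i].eq_lower_or_upper_or_third y with h | h | rfl
    · exact absurd h hl
    · exact absurd h hu
    · exact hthird i
  | riseFall i =>
    unfold riseIn fallOut
    by_cases hv : o.IsVertical i
    · rcases id hv with ⟨ha, hb⟩ | ⟨ha, hb⟩ <;>
        simp only [ha, hb, if_true, if_false, Bool.false_eq_true]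
      · exact (hver i hv).1
      · exact (hver i hv).2.symm
    · have h := hv
      rw [isVertical_iff, not_not] at h
      cases hb : o.right (i.castSucc, D[i].upper) <;> rw [hb] at h <;>
        simp only [h, if_true, if_false, Bool.false_eq_true]
      · exact (hhor i hv _).symm
      · exact hhor i hv _
  | fallRise i =>
    unfold fallIn riseOut
    by_cases hv : o.IsVertical i
    · rcases id hv with ⟨ha, hb⟩ | ⟨ha, hb⟩ <;>
        simp only [ha, hb, if_true, if_false, Bool.false_eq_true]
      · exact (hver i hv).2
      · exact (hver i hv).1.symm
    · have h := hv
      rw [isVertical_iff, not_not] at h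
      cases hb : o.right (i.castSucc, D[i].upper) <;> rw [hb] at h <;>
        simp only [h, if_true, if_false, Bool.false_eq_true]
      · exact (hhor i hv _).symm
      · exact hhor i hv _
  | leftCap => exact hleft
  | rightCap => exact hright
  | freeEnds => exact hfree

theorem joined_of_forall_not_isVertical {a b : Fin (D.length + 1)} (hab : a ≤ b)
    (h : ∀ k : Fin D.length, a ≤ k.castSucc → k.castSucc < b → ¬ o.IsVertical k) (y : Fin 3) :
    o.Joined (a, y) (b, y) := by
  induction b using Fin.induction with
  | zero => rw [Fin.le_zero_iff.1 hab]
  | succ i ih =>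
    rcases hab.eq_or_lt with rfl | hlt
    · rfl
    · have hle : a ≤ i.castSucc := Fin.le_castSucc_iff.2 hlt
      exact (ih hle fun k h1 h2 => h k h1 (h2.trans Fin.castSucc_lt_succ)).trans
        (joined_of_not_isVertical (h i hle Fin.castSucc_lt_succ) y)

end Diagram.Orientation

/-! ### Consecutive vertical crossings. -/

namespace Diagram

variable {D : Diagram}

theorem rightCapLow_ne_rightFree : D.rightCapLow ≠ D.rightFree := by
  unfold rightCapLow rightFree
  split_ifs <;> decide

theorem rightCapHigh_ne_rightFree : D.rightCapHigh ≠ D.rightFree := by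
  unfold rightCapHigh rightFree
  split_ifs <;> decide

namespace Orientation

variable {o : D.Orientation}

variable (o) in
/-- Either no crossing before a column is vertically-smoothed, or there is a last one. -/
theorem exists_last_isVertical (c : Fin (D.length + 1)) :
    (∀ k : Fin D.length, k.castSucc < c → ¬ o.IsVertical k) ∨
      ∃ j : Fin D.length, j.succ ≤ c ∧ o.IsVertical j ∧
        ∀ k, j < k → k.castSucc < c → ¬ o.IsVertical k := by
  by_cases h : ∃ j : Fin D.length, j.castSucc < c ∧ o.IsVertical j
  · right
    obtain ⟨j, ⟨hj, hv⟩, hmax⟩ := WellFounded.has_min (wellFounded_gt (α := Fin D.length))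
      {j | j.castSucc < c ∧ o.IsVertical j} h
    exact ⟨j, Fin.castSucc_lt_iff_succ_le.1 hj, hv, fun k hk hkc hkv => hmax k ⟨hkc, hkv⟩ hk⟩
  · left
    exact fun k hk hv => h ⟨k, hk, hv⟩

theorem IsVertical.exists_next_of_not_isViable {i : Fin D.length} (h : o.IsVertical i)
    (hi : ¬ o.IsViable i) : ∃ j, i < j ∧ o.IsVertical j ∧
      (∀ k, i < k → k < j → ¬ o.IsVertical k) ∧ D[j].pos ≠ D[i].pos := by
  have hex : ∃ j, i < j ∧ o.IsVertical j := by
    by_contra! hne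
    exact hi ⟨h, Or.inr hne⟩
  obtain ⟨j, ⟨hj, hv⟩, hmin⟩ := WellFounded.has_min (wellFounded_lt (α := Fin D.length))
    {j | i < j ∧ o.IsVertical j} hex
  have hbetween : ∀ k, i < k → k < j → ¬ o.IsVertical k :=
    fun k hk hkj hkv => hmin k ⟨hk, hkv⟩ hkj
  exact ⟨j, hj, hv, hbetween, fun hp => hi ⟨h, Or.inl ⟨j, hj, hv, hbetween, hp⟩⟩⟩

/-- To the right of a vertically-smoothed crossing which is not viable, all three points are on
the same Seifert circle. -/
theorem IsVertical.joined_of_not_isViable {i : Fin D.length} (h : o.IsVertical i)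
    (hi : ¬ o.IsViable i) (y z : Fin 3) : o.Joined (i.succ, y) (i.succ, z) := by
  obtain ⟨j, hij, hj, hbetween, hpos⟩ := h.exists_next_of_not_isViable hi
  have hor : ∀ y, o.Joined (i.succ, y) (j.castSucc, y) :=
    joined_of_forall_not_isVertical (Fin.succ_le_castSucc_iff.2 hij) fun k h1 h2 =>
      hbetween k (Fin.succ_le_castSucc_iff.1 h1) (Fin.castSucc_lt_castSucc_iff.1 h2)
  have h1 := h.joined.2
  have h2 := ((hor _).trans hj.joined.1).trans (hor _).symm
  -- One of the two crossings joins heights 0 and 1, the other 1 and 2; height 1 is common to both.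
  have key : ∀ y, o.Joined (i.succ, y) (i.succ, 1) := by
    rcases D[i].pos_eq_zero_or_one with hp | hp <;> rcases D[j].pos_eq_zero_or_one with hq | hq <;>
      simp only [hp, hq, ne_eq, not_true_eq_false] at hpos <;>
      simp only [Crossing.lower, Crossing.upper, hp, hq] at h1 h2 <;>
      intro y <;> fin_cases y
    · exact h1
    · rfl
    · exact h2.symm
    · exact h2
    · rfl
    · exact h1.symm
  exact (key y).trans (key z).symm

/-! ### Labelling the Seifert circles. -/

open Classical in
variable (o) in
/-- The Seifert circle through a point: `none` for the circle which contains the arc through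
infinity, `some none` for the circle that starts with the left cap, and `some (some i)` for the
circle between the viable crossing `i` and the next vertically-smoothed crossing or the right
cap. -/
noncomputable def label : Fin (D.length + 1) → Fin 3 → Option (Option {i // o.IsViable i}) :=
  Fin.induction (fun y => if y = 0 then none else some none) fun i prev y =>
    if o.IsVertical i then
      if h : o.IsViable i ∧ y ≠ D[i].third then some (some ⟨i, h.1⟩) else none
    else prev y

theorem label_zero (y : Fin 3) : o.label 0 y = if y = 0 then none else some none := by
  simp [label]

theorem label_succ_of_not_isVertical {i : Fin D.length} (h : ¬ o.IsVertical i) (y : Fin 3) :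
    o.label i.succ y = o.label i.castSucc y := by
  simp [label, h]

theorem IsViable.label_succ {i : Fin D.length} (h : o.IsViable i) (y : Fin 3) :
    o.label i.succ y = if y = D[i].third then none else some (some ⟨i, h⟩) := by
  by_cases hy : y = D[i].third <;>
    simp only [label, Fin.induction_succ, h.1, h, hy, if_true, if_false, ne_eq, not_true_eq_false,
      not_false_eq_true, and_self, and_false, dite_true, dite_false]

theorem IsVertical.label_succ_of_not_isViable {i : Fin D.length} (h : o.IsVertical i)
    (hi : ¬ o.IsViable i) (y : Fin 3) : o.label i.succ y = none := by
  simp [label, h, hi]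

theorem IsVertical.label_succ_third {i : Fin D.length} (h : o.IsVertical i) :
    o.label i.succ D[i].third = none := by
  by_cases hi : o.IsViable i
  · rw [hi.label_succ, if_pos rfl]
  · exact h.label_succ_of_not_isViable hi _

theorem IsVertical.label_succ_eq {i : Fin D.length} (h : o.IsVertical i) {y z : Fin 3}
    (hy : y ≠ D[i].third) (hz : z ≠ D[i].third) : o.label i.succ y = o.label i.succ z := by
  by_cases hi : o.IsViable i
  · rw [hi.label_succ, hi.label_succ, if_neg hy, if_neg hz]
  · rw [h.label_succ_of_not_isViable hi, h.label_succ_of_not_isViable hi]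

theorem label_eq_of_forall_not_isVertical {a b : Fin (D.length + 1)} (hab : a ≤ b)
    (h : ∀ k : Fin D.length, a ≤ k.castSucc → k.castSucc < b → ¬ o.IsVertical k) (y : Fin 3) :
    o.label b y = o.label a y := by
  induction b using Fin.induction with
  | zero => rw [Fin.le_zero_iff.1 hab]
  | succ i ih =>
    rcases hab.eq_or_lt with rfl | hlt
    · rfl
    · have hle : a ≤ i.castSucc := Fin.le_castSucc_iff.2 hlt
      rw [label_succ_of_not_isVertical (h i hle Fin.castSucc_lt_succ),
        ih hle fun k h1 h2 => h k h1 (h2.trans Fin.castSucc_lt_succ)]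

/-- To the left of a vertically-smoothed crossing, the strand passing it is on the circle through
infinity, and the other two points are on the same circle. -/
theorem IsVertical.label_castSucc
    (hfirst : ∀ i, o.IsVertical i → (∀ k < i, ¬ o.IsVertical k) → D[i].third = 0)
    {i : Fin D.length} (h : o.IsVertical i) :
    o.label i.castSucc D[i].third = none ∧
      ∀ y z, y ≠ D[i].third → z ≠ D[i].third → o.label i.castSucc y = o.label i.castSucc z := by
  rcases o.exists_last_isVertical i.castSucc with hno | ⟨j, hji, hj, hbetween⟩
  · have ht := hfirst i h fun k hk => hno k (Fin.castSucc_lt_castSucc_iff.2 hk)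
    have hl := label_eq_of_forall_not_isVertical (Fin.zero_le i.castSucc) fun k _ hk => hno k hk
    rw [ht]
    refine ⟨by rw [hl, label_zero, if_pos rfl], fun y z hy hz => ?_⟩
    rw [hl, hl, label_zero, label_zero, if_neg hy, if_neg hz]
  · have hl := label_eq_of_forall_not_isVertical hji fun k h1 h2 =>
      hbetween k (Fin.succ_le_castSucc_iff.1 h1) h2
    simp only [hl]
    by_cases hv : o.IsViable j
    -- The next vertical crossing after `j` is `i`, so viability of `j` puts both at the same
    -- height.
    · have ht : D[i].third = D[j].third := by
        have hji' : j < i := Fin.succ_le_castSucc_iff.1 hji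
        rcases hv.2 with ⟨k, hjk, hk, hkb, hp⟩ | hlast
        · have hki : k = i := by
            rcases lt_trichotomy k i with hlt | heq | hgt
            · exact absurd hk (hbetween k hjk (Fin.castSucc_lt_castSucc_iff.2 hlt))
            · exact heq
            · exact absurd h (hkb i hji' hgt)
          rw [← hki, Crossing.third, Crossing.third, hp]
        · exact absurd h (hlast i hji')
      rw [ht]
      exact ⟨hj.label_succ_third, fun y z => hj.label_succ_eq⟩
    · simp [hj.label_succ_of_not_isViable hv]

/-- The labels at the right end are those just after the last vertical crossing. Without one they
are those at the left end, which fit the right closure only if the free end is again at height 0;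
hence `hnone`. -/
theorem label_last
    (hlast : ∀ i, o.IsVertical i → (∀ k, i < k → ¬ o.IsVertical k) → D[i].third = D.rightFree)
    (hnone : (∀ i, ¬ o.IsVertical i) → D.rightFree = 0) :
    o.label (Fin.last _) D.rightFree = none ∧
      ∀ y z, y ≠ D.rightFree → z ≠ D.rightFree →
        o.label (Fin.last _) y = o.label (Fin.last _) z := by
  rcases o.exists_last_isVertical (Fin.last _) with hno | ⟨j, hjl, hj, hbetween⟩
  · have ht := hnone fun k => hno k (Fin.castSucc_lt_last k)
    have hl := label_eq_of_forall_not_isVertical (Fin.zero_le (Fin.last D.length))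
      fun k _ hk => hno k hk
    rw [ht]
    refine ⟨by rw [hl, label_zero, if_pos rfl], fun y z hy hz => ?_⟩
    rw [hl, hl, label_zero, label_zero, if_neg hy, if_neg hz]
  · have hl := label_eq_of_forall_not_isVertical hjl fun k h1 h2 =>
      hbetween k (Fin.succ_le_castSucc_iff.1 h1) h2
    simp only [hl]
    rw [← hlast j hj fun k hk => hbetween k hk (Fin.castSucc_lt_last k)]
    exact ⟨hj.label_succ_third, fun y z => hj.label_succ_eq⟩

variable (o) in
/-- A point on the Seifert circle with a given label. -/
def basePoint : Option (Option {i // o.IsViable i}) → D.Point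
  | none => (0, 0)
  | some none => (0, 1)
  | some (some i) => (i.1.succ, D[i.1].lower)

theorem label_basePoint (l : Option (Option {i // o.IsViable i})) :
    o.label (o.basePoint l).1 (o.basePoint l).2 = l := by
  rcases l with _ | _ | ⟨i, hi⟩
  · simp [basePoint, label_zero]
  · simp [basePoint, label_zero]
  · simp only [basePoint]
    rw [hi.label_succ, if_neg D[i].third_ne_lower.symm]

/-- This makes the labelling injective on components. By induction on columns, the strand passing a
vertical crossing stays on the circle through infinity; after a non-viable crossing the other two
heights are joined to it, and after a viable one they start a new circle. -/
theorem joined_basePoint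
    (hfirst : ∀ i, o.IsVertical i → (∀ k < i, ¬ o.IsVertical k) → D[i].third = 0)
    (c : Fin (D.length + 1)) (y : Fin 3) : o.Joined (c, y) (o.basePoint (o.label c y)) := by
  induction c using Fin.induction generalizing y with
  | zero =>
    rw [label_zero]
    fin_cases y
    · rfl
    · rfl
    · exact (SeifertArc.leftCap (o := o)).joined.symm
  | succ i ih =>
    by_cases hv : o.IsVertical i
    · have hthird : o.Joined (i.succ, D[i].third) (0, 0) := by
        have := ih D[i].third
        rw [(hv.label_castSucc hfirst).1] at this
        exact (joined_third i).symm.trans this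
      by_cases hi : o.IsViable i
      · rw [hi.label_succ]
        rcases D[i].eq_lower_or_upper_or_third y with rfl | rfl | rfl
        · rw [if_neg D[i].third_ne_lower.symm]
          rfl
        · rw [if_neg D[i].third_ne_upper.symm]
          exact hv.joined.2.symm
        · rw [if_pos rfl]
          exact hthird
      · rw [hv.label_succ_of_not_isViable hi]
        exact (hv.joined_of_not_isViable hi _ _).trans hthird
    · rw [label_succ_of_not_isVertical hv]
      exact (joined_of_not_isVertical hv y).symm.trans (ih y)

/-- The number of Seifert circles if the first and the last vertically-smoothed crossing have the
same height as the left and the right cap. -/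
theorem numSeifertCircles_eq
    (hfirst : ∀ i, o.IsVertical i → (∀ k < i, ¬ o.IsVertical k) → D[i].third = 0)
    (hlast : ∀ i, o.IsVertical i → (∀ k, i < k → ¬ o.IsVertical k) → D[i].third = D.rightFree)
    (hnone : (∀ i, ¬ o.IsVertical i) → D.rightFree = 0) :
    o.numSeifertCircles = 2 + {i | o.IsViable i}.ncard := by
  have hend := label_last hlast hnone
  have harc : ∀ {a b : D.Point}, o.SeifertArc a b → o.label a.1 a.2 = o.label b.1 b.2 := by
    refine SeifertArc.map_eq (f := fun p => o.label p.1 p.2) (fun i => ?_)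
      (fun i hv y => (label_succ_of_not_isVertical hv y).symm) (fun i hv => ⟨?_, ?_⟩) ?_ ?_ ?_
    · by_cases hv : o.IsVertical i
      · exact (hv.label_castSucc hfirst).1.trans hv.label_succ_third.symm
      · exact (label_succ_of_not_isVertical hv _).symm
    · exact (hv.label_castSucc hfirst).2 _ _ D[i].third_ne_lower.symm D[i].third_ne_upper.symm
    · exact hv.label_succ_eq D[i].third_ne_lower.symm D[i].third_ne_upper.symm
    · simp [label_zero]
    · exact hend.2 _ _ rightCapLow_ne_rightFree rightCapHigh_ne_rightFree
    · simp only [hend.1, label_zero, if_true]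
  have hadj : ∀ {a b : D.Point}, (SimpleGraph.fromRel o.SeifertArc).Adj a b →
      o.label a.1 a.2 = o.label b.1 b.2 := by
    intro a b h
    rcases ((SimpleGraph.fromRel_adj _ _ _).1 h).2 with h | h
    · exact harc h
    · exact (harc h).symm
  have hwalk : ∀ (a b : D.Point) (p : (SimpleGraph.fromRel o.SeifertArc).Walk a b), p.IsPath →
      o.label a.1 a.2 = o.label b.1 b.2 := by
    intro a b p _
    induction p with
    | nil => rfl
    | cons h _ ih => exact (hadj h).trans (ih (by simp_all))
  -- Labels are constant on components; base points give surjectivity, and paths to base points give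
  -- injectivity.
  have hbij : Function.Bijective (SimpleGraph.ConnectedComponent.lift _ hwalk) := by
    refine ⟨fun C C' => ?_, fun l => ⟨SimpleGraph.connectedComponentMk _ (o.basePoint l), ?_⟩⟩
    · induction C using SimpleGraph.ConnectedComponent.ind with | _ a
      induction C' using SimpleGraph.ConnectedComponent.ind with | _ b
      intro h
      have h' : o.label a.1 a.2 = o.label b.1 b.2 := h
      have ha := joined_basePoint hfirst a.1 a.2
      rw [h'] at ha
      exact SimpleGraph.ConnectedComponent.sound
        (ha.trans (joined_basePoint hfirst b.1 b.2).symm)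
    · exact label_basePoint l
  rw [numSeifertCircles, Nat.card_congr (Equiv.ofBijective _ hbij), Finite.card_option,
    Finite.card_option, ← Nat.card_coe_set_eq]
  simp only [Set.coe_ofPred]
  omega

/-! ### Heights of the first and last vertical crossings. -/

/-- Orientations do not change before the first vertical crossing, so heights 0 and 1 still agree
there and cannot be the two that meet. -/
theorem third_eq_zero_of_first
    (hl : o.right (0, 0) = o.right (0, 1)) {i : Fin D.length} (hi : o.IsVertical i)
    (h : ∀ k < i, ¬ o.IsVertical k) : D[i].third = 0 := by
  have hr := o.right_eq_of_not_isVertical (Fin.zero_le i.castSucc) fun k _ hk =>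
    h k (Fin.castSucc_lt_castSucc_iff.1 hk)
  rw [isVertical_iff, hr, hr] at hi
  rcases D[i].pos_eq_zero_or_one with hp | hp <;>
    simp only [Crossing.lower, Crossing.upper, Crossing.third, hp] at hi ⊢
  · exact absurd hl hi
  · rfl

theorem third_eq_rightFree_of_last
    (hl : o.right (Fin.last _, D.rightFree) = o.right (Fin.last _, 1)) {i : Fin D.length}
    (hi : o.IsVertical i) (h : ∀ k, i < k → ¬ o.IsVertical k) : D[i].third = D.rightFree := by
  have hr := o.right_eq_of_not_isVertical (Fin.le_last i.succ) fun k hk _ =>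
    h k (Fin.succ_le_castSucc_iff.1 hk)
  -- A crossing only exchanges the two orientations, so they also differ on its right side and hence
  -- at the right end.
  have hi' : o.right (Fin.last _, D[i].lower) ≠ o.right (Fin.last _, D[i].upper) := by
    rw [hr, hr, right_succ, right_succ, Equiv.swap_apply_left, Equiv.swap_apply_right]
    exact ((o.isVertical_iff i).1 hi).symm
  rcases D[i].pos_eq_zero_or_one with hp | hp <;>
    simp only [Crossing.lower, Crossing.upper, Crossing.third, hp] at hi' ⊢ <;>
    unfold rightFree at hl ⊢ <;> by_cases hodd : Odd (List.length D) <;>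
    simp only [hodd, if_true, if_false] at hl ⊢
  · exact absurd hl hi'
  · rfl
  · exact absurd hl.symm hi'

theorem rightFree_eq_zero_of_forall_not_isVertical
    (hr : o.right (Fin.last _, D.rightFree) = o.right (Fin.last _, 1))
    (h : ∀ i, ¬ o.IsVertical i) : D.rightFree = 0 := by
  have hc := o.right_eq_of_not_isVertical (Fin.zero_le (Fin.last _)) fun k _ _ => h k
  have hcap := o.leftCap
  rw [hc, hc] at hr
  unfold rightFree at hr ⊢
  split_ifs at hr ⊢
  · rfl
  -- With the free end at height 2, heights 1 and 2 would agree at the left end, against the left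
  -- cap.
  · rw [hr] at hcap
    simp at hcap

end Orientation

end Diagram

end BilliardKnot

open BilliardKnot.Diagram.Orientation in
theorem mainTheorem3 (w : List BilliardKnot.Sign) (hw : BilliardKnot.IsReducedWord w)
    (o : (BilliardKnot.alternatingDiagram w).Orientation) :
    o.numSeifertCircles = 2 + {i | o.IsViable i}.ncard := by
  obtain ⟨hl, hr⟩ := hw.right_ends o
  exact numSeifertCircles_eq (fun _ => third_eq_zero_of_first hl)
    (fun _ => third_eq_rightFree_of_last hr) (rightFree_eq_zero_of_forall_not_isVertical hr)
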